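/- Let $K$ be a field, $S=K[x_1,\ldots,x_n]$, and let $I\subseteq S$ be a monomial ideal. For a monomial ideal $J$ let $G(J)$ be its unique minimal set of monomial generators, and for a monomial $u=x_1^{a_1}\cdots x_n^{a_n}$ put $\deg_{x_i}(u)=a_i$. For $j\ge 0$ let $I_{\langle j\rangle}$ be the ideal generated by all homogeneous elements of degree $j$ in $I$. A monomial ideal $J$ generated in a single degree (the zero ideal included) is polymatroidal if for all $u,v\in G(J)$ and all $i$ with $\deg_{x_i}(u)>\deg_{x_i}(v)$ there is an index $k$ with $\deg_{x_k}(u)<\deg_{x_k}(v)$ such that $x_k(u/x_i)\in J$. A polymatroidal ideal $J$ has the strong exchange property if for all $u,v\in G(J)$ and all $i,k$ with $\deg_{x_i}(u)>\deg_{x_i}(v)$ and $\deg_{x_k}(u)<\deg_{x_k}(v)$ one has $x_k(u/x_i)\in J$. Theorem. Suppose that for every $j\ge 0$ the ideal $I_{\langle j\rangle}$ is polymatroidal and has the strong exchange property. Then $I$ has linear quotients; that is, there is an ordering $u_1,\ldots,u_m$ of the elements of $G(I)$ such that for each $i=2,\ldots,m$ the colon ideal $(u_1,\ldots,u_{i-1}):u_i$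 is generated by a subset of the variables $x_1,\ldots,x_n$. -/

import Mathlib

namespace MonomialIdeals

open MvPolynomial

/-- The monomial `x^a` of the polynomial ring `K[x_1, …, x_n]`; monomials are identified with
their exponent vectors `a`, so that `deg_{x_i}(x^a) = a i`. -/
noncomputable def mono (K : Type*) [Field K] {n : ℕ} (a : Fin n →₀ ℕ) :
    MvPolynomial (Fin n) K :=
  monomial a 1

/-- `I` is a monomial ideal: it is generated by a set of monomials. -/
def IsMonomialIdeal {K : Type*} [Field K] {n : ℕ} (I : Ideal (MvPolynomial (Fin n) K)) : Prop :=
  ∃ A : Set (Fin n →₀ ℕ), I = Ideal.span (mono K '' A)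

/-- `G(I)`, the minimal monomial generators of a monomial ideal `I` (as exponent vectors): the
monomials in `I` that are minimal with respect to divisibility. -/
def minGens {K : Type*} [Field K] {n : ℕ} (I : Ideal (MvPolynomial (Fin n) K)) :
    Set (Fin n →₀ ℕ) :=
  {a | Minimal (fun b => mono K b ∈ I) a}

/-- `I_⟨j⟩`, the ideal generated by the homogeneous elements of degree `j` of `I`. -/
noncomputable def gradedComponent {K : Type*} [Field K] {n : ℕ} (I : Ideal (MvPolynomial (Fin n) K)) (j : ℕ) :
    Ideal (MvPolynomial (Fin n) K) :=
  Ideal.span {f | f ∈ I ∧ f.IsHomogeneous j}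

/-- `I` is a polymatroidal ideal: a monomial ideal generated in a single degree whose minimal
generators satisfy the exchange property. The exponent vector of `x_j (u / x_i)` is
`u - single i 1 + single j 1`, an honest difference because `0 ≤ v i < u i`. -/
structure IsPolymatroidal {K : Type*} [Field K] {n : ℕ}
    (I : Ideal (MvPolynomial (Fin n) K)) : Prop where
  isMonomialIdeal : IsMonomialIdeal I
  single_degree : ∃ d : ℕ, ∀ u ∈ minGens I, u.degree = d
  exchange : ∀ u ∈ minGens I, ∀ v ∈ minGens I, ∀ i, v i < u i →
    ∃ j, u j < v j ∧ mono K (u - Finsupp.single i 1 + Finsupp.single j 1) ∈ I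

/-- The strong exchange property (of a polymatroidal ideal). -/
def StrongExchange {K : Type*} [Field K] {n : ℕ} (I : Ideal (MvPolynomial (Fin n) K)) : Prop :=
  ∀ u ∈ minGens I, ∀ v ∈ minGens I, ∀ i j, v i < u i → u j < v j →
    mono K (u - Finsupp.single i 1 + Finsupp.single j 1) ∈ I

/-- `I` is a monomial ideal that is componentwise polymatroidal with strong exchange property. -/
structure IsComponentwisePolymatroidalStrong {K : Type*} [Field K] {n : ℕ}
    (I : Ideal (MvPolynomial (Fin n) K)) : Prop where
  isMonomialIdeal : IsMonomialIdeal I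
  polymatroidal : ∀ j : ℕ, IsPolymatroidal (gradedComponent I j)
  strongExchange : ∀ j : ℕ, StrongExchange (gradedComponent I j)

/-- `I` has linear quotients: `I` is a monomial ideal and there is an ordering `u_0, …, u_{m-1}`
of its minimal monomial generators such that for every `i > 0` the colon ideal
`(u_0, …, u_{i-1}) : u_i` is generated by a subset of the variables. -/
def HasLinearQuotients {K : Type*} [Field K] {n : ℕ} (I : Ideal (MvPolynomial (Fin n) K)) :
    Prop :=
  IsMonomialIdeal I ∧
    ∃ (m : ℕ) (u : Fin m → (Fin n →₀ ℕ)), Function.Injective u ∧ Set.range u = minGens I ∧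
      ∀ i : Fin m, 0 < (i : ℕ) → ∃ T : Set (Fin n),
        (Ideal.span ((fun k => mono K (u k)) '' Set.Iio i)).colon {mono K (u i)} =
          Ideal.span ((X : Fin n → MvPolynomial (Fin n) K) '' T)

end MonomialIdeals

/-!
Identify monomials with exponent vectors and let `M` be the upper set of exponents of monomials
in `I`. The generators of `I_⟨d⟩` are then the vectors of `M` of degree `d` (the layer of
degree `d`), and each layer has strong exchange.

A set of vectors of one degree with strong exchange consists of all lattice points of that degree
in a box (`HasStrongExchange.mem_of_between`). The minimal generators `u` of `I` are ordered by
degree `d`, then by the `ℓ¹` distance from `u` to the box of the layer of degree `d - 1`, then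
lexicographically with large vectors first (`orderKey`). Since colon ideals of monomial ideals can
be computed on exponents, linear quotients mean that whenever `v` precedes `u`, there is an index
`k` with `u k < v k` such that `x_k u` is divisible by a generator preceding `u`. Such a divisor is
found below a vector `x_k (u / x_a)` in `M`, which itself precedes `u`:

* If `v` has smaller degree, it is raised inside `lcm(u, v)` to a vector `V` of degree `d - 1`.
  Minimality of `u` and the box description force `u` to lie outside the box, and exchanging with
  `V` a coordinate in which `u` leaves the box decreases the distance
  (`exists_transfer_of_degree_le`).
* If `v` has the same degree, strong exchange with `v` allows all transfers from a coordinate where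
  `u` exceeds `v` to one where `v` exceeds `u`. The distance is a separable convex function, so
  either some transfer decreases it, or `u` and `v` are equally far from the box and a transfer to
  the first coordinate where they differ keeps the distance and increases `u` lexicographically
  (`boxDist_le_and_lt_of_transfer`).
-/

namespace MonomialIdeals

/-! ### Strong exchange for sets of exponent vectors -/

section Exchange

variable {σ : Type*}

/-- The exponent vector of `x_k (u / x_i)`; meaningful when `0 < u i`. -/
noncomputable def transfer (u : σ →₀ ℕ) (i k : σ) : σ →₀ ℕ :=
  u - Finsupp.single i 1 + Finsupp.single k 1

theorem transfer_apply_source (u : σ →₀ ℕ) {i k : σ} (h : i ≠ k) :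
    transfer u i k i = u i - 1 := by
  simp [transfer, h]

theorem transfer_apply_target (u : σ →₀ ℕ) {i k : σ} (h : i ≠ k) :
    transfer u i k k = u k + 1 := by
  simp [transfer, h]

theorem transfer_apply_of_ne (u : σ →₀ ℕ) {i k l : σ} (hi : l ≠ i) (hk : l ≠ k) :
    transfer u i k l = u l := by
  simp [transfer, hi.symm, hk.symm]

theorem degree_transfer (u : σ →₀ ℕ) {i : σ} (k : σ) (h : 0 < u i) :
    (transfer u i k).degree = u.degree := by
  have hle : Finsupp.single i 1 ≤ u := Finsupp.single_le_iff.2 h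
  have := congrArg Finsupp.degree (tsub_add_cancel_of_le hle)
  simp only [map_add, Finsupp.degree_single] at this
  simpa [transfer] using this

theorem transfer_le (u : σ →₀ ℕ) (i k : σ) : transfer u i k ≤ u + Finsupp.single k 1 :=
  add_le_add_left tsub_le_self _

/-- Strong exchange for a set of exponent vectors (in use, vectors of one common degree). -/
def HasStrongExchange (M : Set (σ →₀ ℕ)) : Prop :=
  ∀ u ∈ M, ∀ v ∈ M, ∀ i k, v i < u i → u k < v k → transfer u i k ∈ M

theorem exists_degree_eq_between {v w : σ →₀ ℕ} (h : v ≤ w) {d : ℕ} (hv : v.degree ≤ d)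
    (hw : d ≤ w.degree) : ∃ V, v ≤ V ∧ V ≤ w ∧ V.degree = d := by
  have hadd := congrArg Finsupp.degree (add_tsub_cancel_of_le h)
  rw [map_add] at hadd
  obtain ⟨y, hy, hyd⟩ := Finsupp.exists_le_degree_eq (w - v) (d - v.degree) (by omega)
  refine ⟨v + y, le_self_add, ?_, by rw [map_add, hyd]; omega⟩
  exact (add_le_add_right hy v).trans_eq (add_tsub_cancel_of_le h)

variable [Fintype σ]

theorem exists_lt_of_degree_le {u v : σ →₀ ℕ} (hd : u.degree ≤ v.degree) {a : σ}
    (h : v a < u a) : ∃ k, u k < v k := by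
  by_contra! hc
  rw [Finsupp.degree_eq_sum, Finsupp.degree_eq_sum] at hd
  exact absurd hd (not_le.2 (Finset.sum_lt_sum (fun k _ => hc k) ⟨a, Finset.mem_univ _, h⟩))

/-- If some member exceeds `V` at `k` and some member is below `V` at `a`, one member does both:
starting from one exceeding `V` at `k`, units are moved away from the coordinate `a` until it drops
below `V a`. -/
theorem HasStrongExchange.exists_lt_and_lt {M : Set (σ →₀ ℕ)} (hM : HasStrongExchange M) {d : ℕ}
    (hd : ∀ u ∈ M, u.degree = d) {V p q : σ →₀ ℕ} (hp : p ∈ M) (hq : q ∈ M) {k a : σ}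
    (hka : k ≠ a) (hpk : V k < p k) (hqa : q a < V a) : ∃ r ∈ M, V k < r k ∧ r a < V a := by
  induction hN : p a using Nat.strong_induction_on generalizing p with
  | _ N ih =>
    by_cases hpa : p a < V a
    · exact ⟨p, hp, hpk, hpa⟩
    by_cases hqk : V k < q k
    · exact ⟨q, hq, hqk, hqa⟩
    obtain ⟨m, hm⟩ := exists_lt_of_degree_le ((hd p hp).trans (hd q hq).symm).le
      (show q a < p a by omega)
    have hmk : m ≠ k := by rintro rfl; omega
    have ham : a ≠ m := by rintro rfl; omega
    have hr := hM p hp q hq a m (by omega) hm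
    have hra := transfer_apply_source p ham
    refine ih _ (by rw [hra]; omega) hr ?_ rfl
    rwa [transfer_apply_of_ne p hka hmk.symm]

/-- A set with strong exchange lying in one degree contains every vector of that degree whose
coordinates are between values taken on the set. Hence it is the set of lattice points of a box in
that degree. -/
theorem HasStrongExchange.mem_of_between {M : Set (σ →₀ ℕ)} (hM : HasStrongExchange M) {d : ℕ}
    (hd : ∀ u ∈ M, u.degree = d) (hne : M.Nonempty) {x : σ →₀ ℕ} (hx : x.degree = d)
    (hlo : ∀ a, ∃ q ∈ M, q a ≤ x a) (hhi : ∀ k, ∃ p ∈ M, x k ≤ p k) : x ∈ M := by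
  obtain ⟨V, hV⟩ := hne
  induction hN : ∑ l, (x l - V l) using Nat.strong_induction_on generalizing V with
  | _ N ih =>
    by_cases hxV : x = V
    · exact hxV ▸ hV
    obtain ⟨l, hl⟩ := DFunLike.ne_iff.1 hxV
    have hdeg : x.degree = V.degree := hx.trans (hd V hV).symm
    obtain ⟨k, hk⟩ : ∃ k, V k < x k := by
      rcases lt_or_gt_of_ne hl with h | h
      · exact exists_lt_of_degree_le hdeg.ge h
      · exact ⟨l, h⟩
    obtain ⟨a, ha⟩ := exists_lt_of_degree_le hdeg.le hk
    obtain ⟨p, hp, hpk⟩ := hhi k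
    obtain ⟨q, hq, hqa⟩ := hlo a
    have hak : a ≠ k := by rintro rfl; omega
    obtain ⟨r, hr, hrk, hra⟩ :=
      hM.exists_lt_and_lt hd hp hq hak.symm (hk.trans_le hpk) (hqa.trans_lt ha)
    have h1 := transfer_apply_source V hak
    have h2 := transfer_apply_target V hak
    refine ih _ ?_ _ (hM V hV r hr a k hra hrk) rfl
    rw [← hN]
    refine Finset.sum_lt_sum (fun m _ => ?_) ⟨k, Finset.mem_univ _, by omega⟩
    by_cases hma : m = a
    · subst hma; omega
    by_cases hmk : m = k
    · subst hmk; omega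
    rw [transfer_apply_of_ne V hma hmk]

end Exchange

/-! ### Layers and the distance to their boxes -/

section Layers

variable {σ : Type*}

/-- The members of `M` of degree `d`. -/
def layer (M : Set (σ →₀ ℕ)) (d : ℕ) : Set (σ →₀ ℕ) := {x | x ∈ M ∧ x.degree = d}

/-- The least value of the coordinate `k` on the degree `d` layer (`0` if the layer is empty). -/
noncomputable def layerMin (M : Set (σ →₀ ℕ)) (d : ℕ) (k : σ) : ℕ :=
  sInf ((fun x => x k) '' layer M d)

/-- The largest value of the coordinate `k` on the degree `d` layer (`0` if the layer is
empty). -/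
noncomputable def layerMax (M : Set (σ →₀ ℕ)) (d : ℕ) (k : σ) : ℕ :=
  sSup ((fun x => x k) '' layer M d)

theorem bddAbove_layer (M : Set (σ →₀ ℕ)) (d : ℕ) (k : σ) :
    BddAbove ((fun x => x k) '' layer M d) := by
  refine ⟨d, ?_⟩
  rintro _ ⟨x, hx, rfl⟩
  exact (Finsupp.le_degree k x).trans hx.2.le

theorem layerMin_le {M : Set (σ →₀ ℕ)} {d : ℕ} {x : σ →₀ ℕ} (hx : x ∈ layer M d) (k : σ) :
    layerMin M d k ≤ x k :=
  Nat.sInf_le ⟨x, hx, rfl⟩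

theorem le_layerMax {M : Set (σ →₀ ℕ)} {d : ℕ} {x : σ →₀ ℕ} (hx : x ∈ layer M d) (k : σ) :
    x k ≤ layerMax M d k :=
  le_csSup (bddAbove_layer M d k) ⟨x, hx, rfl⟩

variable [Fintype σ]

theorem mem_layer_of_layerMin_le_of_le_layerMax {M : Set (σ →₀ ℕ)} {d : ℕ}
    (hM : HasStrongExchange (layer M d)) (hne : (layer M d).Nonempty) {x : σ →₀ ℕ}
    (hx : x.degree = d) (hlo : ∀ k, layerMin M d k ≤ x k) (hhi : ∀ k, x k ≤ layerMax M d k) :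
    x ∈ layer M d := by
  refine hM.mem_of_between (fun u hu => hu.2) hne hx (fun a => ?_) (fun k => ?_)
  · obtain ⟨q, hq, h⟩ := Nat.sInf_mem (hne.image fun x => x a)
    exact ⟨q, hq, (le_of_eq h).trans (hlo a)⟩
  · obtain ⟨p, hp, h⟩ := Nat.sSup_mem (hne.image fun x => x k) (bddAbove_layer M d k)
    exact ⟨p, hp, (hhi k).trans (le_of_eq h.symm)⟩

/-- The `ℓ¹` distance from `x` to the box `∏ [l k, c k]` (for `l ≤ c`), written with truncated
subtraction. It is a separable convex function with slopes `-1`, `0`, `1` in each coordinate. -/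
def boxDist (l c : σ → ℕ) (x : σ →₀ ℕ) : ℕ := ∑ k, ((l k - x k) + (x k - c k))

/-- Moving a unit from `a` to `k` changes only the two corresponding summands. -/
theorem boxDist_transfer [DecidableEq σ] (l c : σ → ℕ) (u : σ →₀ ℕ) {a k : σ} (h : a ≠ k) :
    boxDist l c (transfer u a k) +
        (((l a - u a) + (u a - c a)) + ((l k - u k) + (u k - c k))) =
      boxDist l c u +
        (((l a - (u a - 1)) + (u a - 1 - c a)) + ((l k - (u k + 1)) + (u k + 1 - c k))) := by
  have key : ∀ x : σ →₀ ℕ, boxDist l c x = ((l a - x a) + (x a - c a)) +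
      (((l k - x k) + (x k - c k)) +
        ∑ m ∈ (Finset.univ.erase a).erase k, ((l m - x m) + (x m - c m))) := by
    intro x
    rw [Finset.add_sum_erase _ (fun m => (l m - x m) + (x m - c m))
      (Finset.mem_erase.2 ⟨h.symm, Finset.mem_univ k⟩),
      Finset.add_sum_erase _ (fun m => (l m - x m) + (x m - c m)) (Finset.mem_univ a), boxDist]
  have hs : ∑ m ∈ (Finset.univ.erase a).erase k,
        ((l m - transfer u a k m) + (transfer u a k m - c m)) =
      ∑ m ∈ (Finset.univ.erase a).erase k, ((l m - u m) + (u m - c m)) := by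
    refine Finset.sum_congr rfl fun m hm => ?_
    rw [Finset.mem_erase, Finset.mem_erase] at hm
    rw [transfer_apply_of_ne u hm.2.1 hm.1]
  rw [key u, key (transfer u a k), hs, transfer_apply_source u h, transfer_apply_target u h]
  omega

/-- Call `a` a surplus coordinate of `u` if `v a < u a` and `k` a deficit coordinate if
`u k < v k`. If no transfer from a surplus to a deficit coordinate decreases the distance, then
the distance of `v` is at least that of `u`; it is larger if moreover every transfer to the deficit
coordinate `k₀` increases the distance. -/
theorem boxDist_le_and_lt_of_transfer [DecidableEq σ] (l c : σ → ℕ) {u v : σ →₀ ℕ}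
    (hdeg : u.degree = v.degree) {k₀ : σ} (hk₀ : u k₀ < v k₀)
    (hle : ∀ a k, v a < u a → u k < v k → boxDist l c u ≤ boxDist l c (transfer u a k)) :
    boxDist l c u ≤ boxDist l c v ∧
      ((∀ a, v a < u a → boxDist l c u < boxDist l c (transfer u a k₀)) →
        boxDist l c u < boxDist l c v) := by
  obtain ⟨a₁, ha₁⟩ := exists_lt_of_degree_le hdeg.ge hk₀
  -- `b` is the largest left slope of the summands at the surplus coordinates.
  obtain ⟨a₀, ha₀, hmax⟩ := Finset.exists_max_image (Finset.univ.filter fun a => v a < u a)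
    (fun a => (((l a - u a) + (u a - c a) : ℕ) : ℤ) -
      (((l a - (u a - 1)) + (u a - 1 - c a) : ℕ) : ℤ))
    ⟨a₁, by simpa using ha₁⟩
  simp only [Finset.mem_filter, Finset.mem_univ, true_and] at ha₀ hmax
  obtain ⟨b, hb⟩ : ∃ b : ℤ, b = (((l a₀ - u a₀) + (u a₀ - c a₀) : ℕ) : ℤ) -
    (((l a₀ - (u a₀ - 1)) + (u a₀ - 1 - c a₀) : ℕ) : ℤ) := ⟨_, rfl⟩
  rw [← hb] at hmax
  have hb3 : b = -1 ∨ b = 0 ∨ b = 1 := by omega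
  -- By convexity each summand changes from `u` to `v` at least as the linear function of slope `b`.
  have hpt : ∀ k, b * ((v k : ℤ) - u k) ≤
      (((l k - v k) + (v k - c k) : ℕ) : ℤ) - (((l k - u k) + (u k - c k) : ℕ) : ℤ) := by
    intro k
    rcases lt_trichotomy (v k) (u k) with h | h | h
    · have := hmax k h
      rcases hb3 with rfl | rfl | rfl <;> omega
    · simp [h]
    · have h1 := hle a₀ k ha₀ h
      have h2 := boxDist_transfer l c u (show a₀ ≠ k by rintro rfl; omega)
      rcases hb3 with rfl | rfl | rfl <;> omega
  have hsum : ∑ k, b * ((v k : ℤ) - u k) = 0 := by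
    rw [Finsupp.degree_eq_sum, Finsupp.degree_eq_sum] at hdeg
    rw [← Finset.mul_sum, Finset.sum_sub_distrib, ← Nat.cast_sum, ← Nat.cast_sum, hdeg, sub_self,
      mul_zero]
  have hdiff : ∑ k, ((((l k - v k) + (v k - c k) : ℕ) : ℤ) -
      (((l k - u k) + (u k - c k) : ℕ) : ℤ)) = (boxDist l c v : ℤ) - boxDist l c u := by
    rw [Finset.sum_sub_distrib, ← Nat.cast_sum, ← Nat.cast_sum, boxDist, boxDist]
  constructor
  · have := Finset.sum_le_sum fun k (_ : k ∈ Finset.univ) => hpt k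
    omega
  · intro hlt
    have h1 := hlt a₀ ha₀
    have h2 := boxDist_transfer l c u (show a₀ ≠ k₀ by rintro rfl; omega)
    have hstrict : b * ((v k₀ : ℤ) - u k₀) < (((l k₀ - v k₀) + (v k₀ - c k₀) : ℕ) : ℤ) -
        (((l k₀ - u k₀) + (u k₀ - c k₀) : ℕ) : ℤ) := by
      rcases hb3 with rfl | rfl | rfl <;> omega
    have := Finset.sum_lt_sum (fun k (_ : k ∈ Finset.univ) => hpt k)
      ⟨k₀, Finset.mem_univ _, hstrict⟩
    omega

/-- Comparison of a minimal element `u` of degree `d + 1` with an element `v` of smaller degree: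
some transfer towards a coordinate where `v` exceeds `u` stays in `M` and brings `u` closer to
the box of the layer of degree `d`. -/
theorem exists_transfer_of_degree_le [DecidableEq σ] {M : Set (σ →₀ ℕ)} (hup : IsUpperSet M)
    (hM : ∀ d, HasStrongExchange (layer M d)) {d : ℕ} {u v : σ →₀ ℕ}
    (hu : Minimal (· ∈ M) u) (hud : u.degree = d + 1) (hv : v ∈ M) (hvd : v.degree ≤ d) :
    ∃ k a, u k < v k ∧ transfer u a k ∈ M ∧ 0 < u a ∧
      boxDist (layerMin M d) (layerMax M d) (transfer u a k) <
        boxDist (layerMin M d) (layerMax M d) u := by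
  -- Raise `v` to degree `d` without exceeding `u` in new coordinates.
  obtain ⟨V, hvV, hVw, hVd⟩ := exists_degree_eq_between (v := v) (w := u ⊔ v) le_sup_right hvd
    ((Nat.le_succ d).trans (hud.ge.trans (Finsupp.degree_mono le_sup_left)))
  have hV : V ∈ layer M d := ⟨hup hvV hv, hVd⟩
  have hkv : ∀ k, u k < V k → u k < v k := fun k hk => by
    have := hVw k
    simp only [Finsupp.sup_apply] at this
    rcases le_sup_iff.1 this with h | h <;> omega
  have hlo := layerMin_le hV
  have hhi := le_layerMax hV
  have hmem : ∀ a k, a ≠ k → V a < u a → u k ≤ V k → transfer u a k ∈ M := by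
    intro a k hak ha hk
    refine (hM (d + 1) u ⟨hu.prop, hud⟩ (V + Finsupp.single k 1)
      ⟨hup le_self_add hV.1, by rw [map_add, hVd, Finsupp.degree_single]⟩ a k ?_ ?_).1
    · simpa [Finsupp.single_apply, hak.symm] using ha
    · simp; omega
  by_cases h1 : ∃ a, layerMax M d a < u a
  · obtain ⟨a, ha⟩ := h1
    have hVu : ∃ k, u k < V k := by
      by_contra! hc
      have := Finsupp.degree_mono (hu.le_of_le hV.1 hc)
      omega
    obtain ⟨k, hk⟩ := hVu
    have hak : a ≠ k := by rintro rfl; have := hhi a; omega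
    refine ⟨k, a, hkv k hk, hmem a k hak ((hhi a).trans_lt ha) hk.le, by omega, ?_⟩
    have := boxDist_transfer (layerMin M d) (layerMax M d) u hak
    have := hlo a
    have := hhi a
    have := hhi k
    omega
  push Not at h1
  by_cases h2 : ∃ k, u k < layerMin M d k
  · obtain ⟨k, hk⟩ := h2
    have hVk := hlo k
    obtain ⟨a, ha⟩ := exists_lt_of_degree_le (u := V + Finsupp.single k 1) (v := u) (a := k)
      (by rw [map_add, hVd, Finsupp.degree_single, hud]) (by simp; omega)
    have hak : a ≠ k := by rintro rfl; simp at ha; omega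
    have ha' : V a < u a := by simpa [Finsupp.single_apply, hak.symm] using ha
    refine ⟨k, a, hkv k (by omega), hmem a k hak ha' (by omega), by omega, ?_⟩
    have := boxDist_transfer (layerMin M d) (layerMax M d) u hak
    have := hlo a
    have := hhi k
    omega
  push Not at h2
  -- Otherwise `u` lies in the box, and so does a proper divisor of it, contradicting minimality.
  exfalso
  obtain ⟨i, hi⟩ : ∃ i, V i < u i := by
    by_contra! hc
    have := Finsupp.degree_mono (show u ≤ V from hc)
    omega
  have hle : Finsupp.single i 1 ≤ u := Finsupp.single_le_iff.2 (by omega)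
  have hdeg := congrArg Finsupp.degree (tsub_add_cancel_of_le hle)
  rw [map_add, Finsupp.degree_single] at hdeg
  have hx : u - Finsupp.single i 1 ∈ layer M d := by
    refine mem_layer_of_layerMin_le_of_le_layerMax (hM d) ⟨V, hV⟩ (by omega) (fun k => ?_)
      (fun k => tsub_le_self.trans (h1 k))
    by_cases hk : i = k
    · subst hk
      have := hlo i
      simp; omega
    · simpa [Finsupp.single_apply, hk] using h2 k
  have := hu.le_of_le hx.1 tsub_le_self i
  simp at this
  omega

end Layers

/-! ### The order of the generators -/

section Order

variable {n : ℕ}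

/-- The key by which generators are listed: first the degree `d`, then the distance to the box of
the layer of degree `d - 1`, then the lexicographic order with large vectors first. If that
layer is empty, its box is `{0}` and the distance is constant in each degree; the truncation
of `d - 1` at `d = 0` is harmless because there is only one vector of degree `0`. -/
noncomputable def orderKey (M : Set (Fin n →₀ ℕ)) (u : Fin n →₀ ℕ) :
    ℕ ×ₗ ℕ ×ₗ (Lex (Fin n →₀ ℕ))ᵒᵈ :=
  toLex (u.degree, toLex (boxDist (layerMin M (u.degree - 1)) (layerMax M (u.degree - 1)) u,
    OrderDual.toDual (toLex u)))

theorem orderKey_injective (M : Set (Fin n →₀ ℕ)) : Function.Injective (orderKey M) :=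
  fun _ _ h => congrArg
    (fun x : ℕ ×ₗ ℕ ×ₗ (Lex (Fin n →₀ ℕ))ᵒᵈ => ofLex (OrderDual.ofDual (ofLex (ofLex x).2).2)) h

theorem orderKey_lt_iff {M : Set (Fin n →₀ ℕ)} {u v : Fin n →₀ ℕ} :
    orderKey M u < orderKey M v ↔ u.degree < v.degree ∨ u.degree = v.degree ∧
      (boxDist (layerMin M (u.degree - 1)) (layerMax M (u.degree - 1)) u <
          boxDist (layerMin M (v.degree - 1)) (layerMax M (v.degree - 1)) v ∨
        boxDist (layerMin M (u.degree - 1)) (layerMax M (u.degree - 1)) u =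
            boxDist (layerMin M (v.degree - 1)) (layerMax M (v.degree - 1)) v ∧
          ∃ i, (∀ j < i, v j = u j) ∧ v i < u i) := by
  rw [orderKey, orderKey, Prod.Lex.toLex_lt_toLex, Prod.Lex.toLex_lt_toLex,
    OrderDual.toDual_lt_toDual, Finsupp.Lex.lt_iff]
  rfl

/-- Any member of `M` preceding `u` is a multiple of a minimal element preceding `u`. -/
theorem exists_minimal_le_orderKey_lt {M : Set (Fin n →₀ ℕ)} {u x : Fin n →₀ ℕ} (hx : x ∈ M)
    (hlt : orderKey M x < orderKey M u) :
    ∃ w, Minimal (· ∈ M) w ∧ w ≤ x ∧ orderKey M w < orderKey M u := by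
  obtain ⟨w, hwx, hw⟩ := exists_minimal_le_of_wellFoundedLT (· ∈ M) x hx
  refine ⟨w, hw, hwx, ?_⟩
  rcases hwx.eq_or_lt with rfl | h
  · exact hlt
  · have hdeg : w.degree < x.degree := by
      rw [Finsupp.degree_eq_sum, Finsupp.degree_eq_sum]
      obtain ⟨i, hi⟩ := (Finsupp.lt_def.1 h).2
      exact Finset.sum_lt_sum (fun k _ => hwx k) ⟨i, Finset.mem_univ _, hi⟩
    exact (orderKey_lt_iff.2 (Or.inl hdeg)).trans hlt

/-- The combinatorial form of linear quotients: if `v` precedes the minimal element `u`, then some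
minimal element preceding `u` divides `x_k u` for an index `k` with `u k < v k`. -/
theorem exists_minimal_le_add_single {M : Set (Fin n →₀ ℕ)} (hup : IsUpperSet M)
    (hM : ∀ d, HasStrongExchange (layer M d)) {u v : Fin n →₀ ℕ} (hu : Minimal (· ∈ M) u)
    (hv : v ∈ M) (hvu : orderKey M v < orderKey M u) :
    ∃ k, u k < v k ∧ ∃ w, Minimal (· ∈ M) w ∧ w ≤ u + Finsupp.single k 1 ∧
      orderKey M w < orderKey M u := by
  suffices h : ∃ k, u k < v k ∧ ∃ a, transfer u a k ∈ M ∧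
      orderKey M (transfer u a k) < orderKey M u by
    obtain ⟨k, hk, a, hmem, hlt⟩ := h
    obtain ⟨w, hw, hle, hwlt⟩ := exists_minimal_le_orderKey_lt hmem hlt
    exact ⟨k, hk, w, hw, hle.trans (transfer_le u a k), hwlt⟩
  have hcloser : ∀ a k, 0 < u a →
      boxDist (layerMin M (u.degree - 1)) (layerMax M (u.degree - 1)) (transfer u a k) <
        boxDist (layerMin M (u.degree - 1)) (layerMax M (u.degree - 1)) u →
      orderKey M (transfer u a k) < orderKey M u := fun a k ha h => by
    rw [orderKey_lt_iff, degree_transfer u k ha]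
    exact Or.inr ⟨rfl, Or.inl h⟩
  rcases orderKey_lt_iff.1 hvu with hdeg | ⟨hdeg, h⟩
  · obtain ⟨k, a, hk, hmem, ha, hlt⟩ := exists_transfer_of_degree_le hup hM (d := u.degree - 1) hu
      (by omega) hv (by omega)
    exact ⟨k, hk, a, hmem, hcloser a k ha hlt⟩
  have hmem : ∀ a k, v a < u a → u k < v k → transfer u a k ∈ M := fun a k ha hk =>
    (hM u.degree u ⟨hu.prop, rfl⟩ v ⟨hv, hdeg⟩ a k ha hk).1
  by_cases hc : ∃ a k, v a < u a ∧ u k < v k ∧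
      boxDist (layerMin M (u.degree - 1)) (layerMax M (u.degree - 1)) (transfer u a k) <
        boxDist (layerMin M (u.degree - 1)) (layerMax M (u.degree - 1)) u
  · obtain ⟨a, k, ha, hk, hlt⟩ := hc
    exact ⟨k, hk, a, hmem a k ha hk, hcloser a k (by omega) hlt⟩
  push Not at hc
  rw [hdeg] at h
  have hconv := fun k₀ (hk₀ : u k₀ < v k₀) =>
    boxDist_le_and_lt_of_transfer _ _ hdeg.symm hk₀ hc
  rcases h with h | ⟨heq, k, hlex, hk⟩
  · obtain ⟨k, hk⟩ : ∃ k, u k < v k := by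
      by_contra! hle
      have : v = u := hu.eq_of_le hv hle
      exact absurd hvu (this ▸ lt_irrefl _)
    exact absurd h (hconv k hk).1.not_gt
  -- In a tie, convexity provides a transfer to the first differing coordinate that keeps the
  -- distance; it makes the vector lexicographically larger.
  obtain ⟨a, ha, hale⟩ : ∃ a, v a < u a ∧
      boxDist (layerMin M (u.degree - 1)) (layerMax M (u.degree - 1)) (transfer u a k) ≤
        boxDist (layerMin M (u.degree - 1)) (layerMax M (u.degree - 1)) u := by
    by_contra! hall
    exact absurd ((hconv k hk).2 hall) (by rw [heq]; exact lt_irrefl _)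
  have hak : a ≠ k := by rintro rfl; omega
  have hka : k < a := by
    by_contra! hle
    have := hlex a (lt_of_le_of_ne hle hak)
    omega
  refine ⟨k, hk, a, hmem a k ha hk, ?_⟩
  rw [orderKey_lt_iff, degree_transfer u k (by omega)]
  refine Or.inr ⟨rfl, Or.inr ⟨hale.antisymm (hc a k ha hk), k, fun j hj => ?_, ?_⟩⟩
  · rw [transfer_apply_of_ne u (hj.trans hka).ne hj.ne]
  · rw [transfer_apply_target u hak]; omega

/-- A finite set can be listed in the order given by an injective key. -/
theorem exists_enumeration_strictMono {α β : Type*} [LinearOrder β] {G : Set α} (hG : G.Finite)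
    {f : α → β} (hf : Function.Injective f) :
    ∃ (m : ℕ) (u : Fin m → α), StrictMono (f ∘ u) ∧ Set.range u = G := by
  classical
  let S : Finset β := hG.toFinset.image f
  have hS : ∀ i, ∃ a ∈ G, f a = S.orderEmbOfFin rfl i := fun i => by
    have := S.orderEmbOfFin_mem rfl i
    rwa [Finset.mem_image, exists_congr fun a => and_congr_left' hG.mem_toFinset] at this
  choose u huG hu using hS
  have hfu : f ∘ u = S.orderEmbOfFin rfl := funext hu
  refine ⟨S.card, u, hfu ▸ (S.orderEmbOfFin rfl).strictMono, ?_⟩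
  refine Set.Subset.antisymm (Set.range_subset_iff.2 huG) fun a ha => ?_
  have : f a ∈ Set.range (S.orderEmbOfFin rfl) := by
    rw [Finset.range_orderEmbOfFin]
    simpa [S] using ⟨a, ha, rfl⟩
  obtain ⟨i, hi⟩ := this
  exact ⟨i, hf ((hu i).trans hi)⟩

end Order

/-! ### Monomial ideals and exponent vectors -/

section Ideals

open MvPolynomial

variable {K : Type*} [Field K] {n : ℕ}

theorem mem_span_mono_iff {A : Set (Fin n →₀ ℕ)} {f : MvPolynomial (Fin n) K} :
    f ∈ Ideal.span (mono K '' A) ↔ ∀ c ∈ f.support, ∃ b ∈ A, b ≤ c :=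
  mem_ideal_span_monomial_image

theorem mono_mem_span_mono_iff {A : Set (Fin n →₀ ℕ)} {c : Fin n →₀ ℕ} :
    mono K c ∈ Ideal.span (mono K '' A) ↔ ∃ b ∈ A, b ≤ c := by
  simp [mem_span_mono_iff, mono]

theorem isUpperSet_mono_mem (I : Ideal (MvPolynomial (Fin n) K)) :
    IsUpperSet {c | mono K c ∈ I} := by
  intro a b hab ha
  have : mono K b = mono K (b - a) * mono K a := by
    simp [mono, monomial_mul, tsub_add_cancel_of_le hab]
  exact (congrArg (· ∈ I) this).mpr (I.mul_mem_left _ ha)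

theorem IsMonomialIdeal.mono_mem_of_mem_support {I : Ideal (MvPolynomial (Fin n) K)}
    (hI : IsMonomialIdeal I) {f : MvPolynomial (Fin n) K} (hf : f ∈ I) {c : Fin n →₀ ℕ}
    (hc : c ∈ f.support) : mono K c ∈ I := by
  obtain ⟨A, rfl⟩ := hI
  exact mono_mem_span_mono_iff.2 (mem_span_mono_iff.1 hf c hc)

theorem IsMonomialIdeal.gradedComponent_eq {I : Ideal (MvPolynomial (Fin n) K)}
    (hI : IsMonomialIdeal I) (j : ℕ) :
    gradedComponent I j = Ideal.span (mono K '' layer {c | mono K c ∈ I} j) := by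
  refine le_antisymm (Ideal.span_le.2 ?_) (Ideal.span_mono ?_)
  · rintro f ⟨hf, hj⟩
    refine mem_span_mono_iff.2 fun c hc => ⟨c, ⟨hI.mono_mem_of_mem_support hf hc, ?_⟩, le_rfl⟩
    rw [Finsupp.degree_eq_weight_one]
    exact hj (mem_support_iff.1 hc)
  · rintro _ ⟨c, ⟨hc, hj⟩, rfl⟩
    exact ⟨hc, isHomogeneous_monomial 1 hj⟩

theorem IsMonomialIdeal.mono_mem_gradedComponent_iff {I : Ideal (MvPolynomial (Fin n) K)}
    (hI : IsMonomialIdeal I) {j : ℕ} {c : Fin n →₀ ℕ} :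
    mono K c ∈ gradedComponent I j ↔ ∃ b ∈ layer {c | mono K c ∈ I} j, b ≤ c := by
  rw [hI.gradedComponent_eq, mono_mem_span_mono_iff]

theorem IsMonomialIdeal.layer_subset_minGens {I : Ideal (MvPolynomial (Fin n) K)}
    (hI : IsMonomialIdeal I) (j : ℕ) :
    layer {c | mono K c ∈ I} j ⊆ minGens (gradedComponent I j) := by
  intro c hc
  refine ⟨hI.mono_mem_gradedComponent_iff.2 ⟨c, hc, le_rfl⟩, fun b hb hbc => ?_⟩
  obtain ⟨a, ha, hab⟩ := hI.mono_mem_gradedComponent_iff.1 hb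
  -- `a ≤ b ≤ c` with `a` and `c` of the same degree forces `a = c`.
  have hadd := congrArg Finsupp.degree (add_tsub_cancel_of_le (hab.trans hbc))
  rw [map_add, ha.2, hc.2, Nat.add_eq_left, Finsupp.degree_eq_zero_iff, tsub_eq_zero_iff_le] at hadd
  exact hadd.trans hab

theorem IsMonomialIdeal.hasStrongExchange_layer {I : Ideal (MvPolynomial (Fin n) K)}
    (hI : IsMonomialIdeal I) {j : ℕ} (h : StrongExchange (gradedComponent I j)) :
    HasStrongExchange (layer {c | mono K c ∈ I} j) := by
  intro u hu v hv i k hi hk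
  have hmem : mono K (transfer u i k) ∈ gradedComponent I j :=
    h u (hI.layer_subset_minGens j hu) v (hI.layer_subset_minGens j hv) i k hi hk
  obtain ⟨b, hb, hle⟩ := hI.mono_mem_gradedComponent_iff.1 hmem
  exact ⟨isUpperSet_mono_mem I hle hb.1, (degree_transfer u k (by omega)).trans hu.2⟩

/-- A colon ideal `(x^b : b ∈ B) : x^u` is generated by variables as soon as, for each `b ∈ B`,
it contains a variable `x_k` dividing `x^b / gcd(x^b, x^u)`. -/
theorem exists_colon_eq_span_X {B : Set (Fin n →₀ ℕ)} {u : Fin n →₀ ℕ}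
    (h : ∀ b ∈ B, ∃ k, u k < b k ∧ ∃ w ∈ B, w ≤ u + Finsupp.single k 1) :
    ∃ T : Set (Fin n), (Ideal.span (mono K '' B)).colon {mono K u} =
      Ideal.span ((X : Fin n → MvPolynomial (Fin n) K) '' T) := by
  refine ⟨{k | ∃ w ∈ B, w ≤ u + Finsupp.single k 1}, ?_⟩
  ext f
  rw [Submodule.mem_colon_singleton, smul_eq_mul, mem_span_mono_iff, mem_ideal_span_X_image]
  have hsupp : ∀ c, c + u ∈ (f * mono K u).support ↔ c ∈ f.support := fun c => by
    rw [mem_support_iff, mem_support_iff, mono, coeff_mul_monomial, mul_one]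
  constructor
  · intro hf c hc
    obtain ⟨b, hb, hbc⟩ := hf _ ((hsupp c).2 hc)
    obtain ⟨k, hk, hw⟩ := h b hb
    refine ⟨k, hw, ?_⟩
    have := hbc k
    simp only [Finsupp.add_apply] at this
    omega
  · intro hf c' hc'
    have hle : u ≤ c' := by
      by_contra hle
      rw [mem_support_iff, mono, coeff_mul_monomial', if_neg hle] at hc'
      exact hc' rfl
    rw [← tsub_add_cancel_of_le hle, hsupp] at hc'
    obtain ⟨k, ⟨w, hw, hwk⟩, hk⟩ := hf _ hc'
    refine ⟨w, hw, hwk.trans ?_⟩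
    calc u + Finsupp.single k 1 ≤ u + (c' - u) :=
          add_le_add_right (Finsupp.single_le_iff.2 (Nat.one_le_iff_ne_zero.2 hk)) u
      _ = c' := add_tsub_cancel_of_le hle

end Ideals
end MonomialIdeals

open MonomialIdeals

theorem theorem3p9 {K : Type*} [Field K] {n : ℕ} (I : Ideal (MvPolynomial (Fin n) K))
    (hI : MonomialIdeals.IsComponentwisePolymatroidalStrong I) :
    MonomialIdeals.HasLinearQuotients I := by
  refine ⟨hI.isMonomialIdeal, ?_⟩
  have hM := fun d => hI.isMonomialIdeal.hasStrongExchange_layer (hI.strongExchange d)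
  have hfin : (minGens I).Finite :=
    (setOfPred_minimal_antichain _).finite_of_partiallyWellOrderedOn
      (Set.isPWO_of_wellQuasiOrderedLE _)
  obtain ⟨m, u, hmono, hrange⟩ :=
    exists_enumeration_strictMono hfin (orderKey_injective {c | mono K c ∈ I})
  refine ⟨m, u, hmono.injective.of_comp, hrange, fun i _ => ?_⟩
  have hmin : ∀ k, Minimal (· ∈ {c | mono K c ∈ I}) (u k) := fun k =>
    hrange.subset (Set.mem_range_self k)
  have himage : (fun k => mono K (u k)) '' Set.Iio i = mono K '' (u '' Set.Iio i) :=
    (Set.image_image _ _ _).symm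
  rw [himage]
  refine exists_colon_eq_span_X ?_
  rintro _ ⟨k, hk, rfl⟩
  obtain ⟨l, hl, w, hw, hwl, hlt⟩ := exists_minimal_le_add_single (isUpperSet_mono_mem I) hM
    (hmin i) (hmin k).prop (hmono hk)
  obtain ⟨t, rfl⟩ := hrange.superset hw
  exact ⟨l, hl, _, ⟨t, hmono.lt_iff_lt.1 hlt, rfl⟩, hwl⟩
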